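/- Let $m \ge r \ge 2$ be integers, $N = 2^m$, $p \in (0,\tfrac12)$. Let $\mathrm{RM}(m,r) \subseteq \{0,1\}^N$ be the binary Reed-Muller code, i.e. the evaluation vectors $(f(\mathbf z))_{\mathbf z\in\mathbb F_2^m}$ of polynomials $f \in \mathbb F_2[x_1,\dots,x_m]$ of degree at most $r$. A codeword $\mathbf C$ is chosen uniformly at random from $\mathrm{RM}(m,r)$ and sent over the binary symmetric channel $\mathrm{BSC}(p)$: the received word is $\mathbf Y = \mathbf C \oplus \boldsymbol\nu$, where $\boldsymbol\nu$ is independent of $\mathbf C$ and has i.i.d. $\mathrm{Ber}(p)$ coordinates. The RPA (recursive projection-aggregation) decoder for $\mathrm{RM}(m,r)$ with one-dimensional projection subspaces and maximal number of iterations $M_{\mathrm{iter}} \ge 1$ repeats the following round at most $M_{\mathrm{iter}}$ times. For each of the $N-1$ one-dimensional subspaces $\mathbb B$ of $\mathbb F_2^m$, form the projection $\mathbf Y_{/\mathbb B}$, a word of length $N/2$ indexed by the cosets $T \in \mathbb F_2^m/\mathbb B \cong \mathbb F_2^{m-1}$, with $Y_{/\mathbb B}(T) = \bigoplus_{\mathbf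 z \in T} Y_{\mathbf z}$. Decode it to $\widehat{\mathbf Y}_{/\mathbb B}$ with a maximum-likelihood decoder of $\mathrm{RM}(m-1,1)$ if $r = 2$, and recursively with the RPA decoder of $\mathrm{RM}(m-1,r-1)$, with the same $M_{\mathrm{iter}}$, if $r > 2$. Let $\overline{\mathbf Y}$ be $\mathbf Y$ with precisely those coordinates $\mathbf x$ flipped for which $Y_{/\mathbb B}(\mathbf x + \mathbb B) \ne \widehat Y_{/\mathbb B}(\mathbf x + \mathbb B)$ for more than $(N-1)/2$ of the subspaces $\mathbb B$. If $\overline{\mathbf Y} = \mathbf Y$, stop; otherwise replace $\mathbf Y$ by $\overline{\mathbf Y}$. The output $\widehat{\mathbf C}$ is the final $\mathbf Y$. Put $\overline p = \tfrac12\bigl(1-(1-2p)^{2^{r-2}}\bigr)$ and $\eta(\alpha) = \tfrac12\bigl(1-4\alpha(1-\alpha)\bigr)$. Then for every $M_{\mathrm{iter}} \ge 1$, for every linear indexing of the cosets by $\mathbb F_2^{m-1}$, for every tie-breaking rule of the maximum-likelihood decoders, and for every $0 < \epsilon < \eta(\overline p)$, the error probability $P_{\mathrm{err}}(\mathrm{RM}(m,r))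 = \Pr[\widehat{\mathbf C} \ne \mathbf C]$ satisfies $$P_{\mathrm{err}}(\mathrm{RM}(m,r)) \le 32\,N^{r+1}\exp\left(-2^{-r-1}N\epsilon^2\right),$$ and for every fixed $\mathbf c \in \mathrm{RM}(m,r)$ the error probability on transmission of $\mathbf c$ obeys the same bound. -/

import Mathlib

open MeasureTheory ProbabilityTheory

noncomputable section

namespace RPA

/-- The index set `{0,1}^m`, as a vector space over the field with two elements. -/
abbrev Cube (m : ℕ) : Type := Fin m → ZMod 2

/-- Binary vectors of length `2^m`, with coordinates indexed by `{0,1}^m`. -/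
abbrev Word (m : ℕ) : Type := Cube m → ZMod 2

/-- The binary Reed-Muller code `RM(m,r)`: evaluation vectors of the polynomials over the field with
two elements in `m` variables of degree at most `r`. -/
def RM (m r : ℕ) : Set (Word m) :=
  {w | ∃ f : MvPolynomial (Fin m) (ZMod 2), f.totalDegree ≤ r ∧
    w = fun z => MvPolynomial.eval z f}

/-- The one-dimensional subspaces of `{0,1}^m`. -/
abbrev Line (m : ℕ) : Type :=
  {B : Submodule (ZMod 2) (Cube m) // Module.finrank (ZMod 2) B = 1}

/-- A way of indexing the cosets of every one-dimensional subspace `B` of `{0,1}^m` by the vectors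
of `{0,1}^(m-1)`, for all `m`. It is linear, so that the projections of Reed-Muller codewords,
read as words of length `2^(m-1)`, are Reed-Muller codewords again. -/
abbrev CosetIndexing : Type :=
  ∀ (m : ℕ) (B : Line m), (Cube m ⧸ B.1) ≃ₗ[ZMod 2] Cube (m - 1)

open Classical in
/-- The projection of `Y` on the cosets of `B`: the value at a coset `T` is the modulo-2 sum of the
coordinates of `Y` whose index lies in `T`. -/
def cosetSum {m : ℕ} (Y : Word m) (B : Line m) (T : Cube m ⧸ B.1) : ZMod 2 :=
  ∑ z : Cube m with B.1.mkQ z = T, Y z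

/-- The projection of `Y`, read as a word of length `2^(m-1)`. -/
def project (e : CosetIndexing) {m : ℕ} (Y : Word m) (B : Line m) : Word (m - 1) :=
  fun t => cosetSum Y B ((e m B).symm t)

/-- The number `φ(x)` of one-dimensional subspaces `B` for which the projection of `Y` and its
decoded version `Yhat B` disagree at the coset of `x`. -/
def disagreements (e : CosetIndexing) {m : ℕ} (Y : Word m) (Yhat : Line m → Word (m - 1))
    (x : Cube m) : ℕ :=
  Nat.card {B : Line m // cosetSum Y B (B.1.mkQ x) ≠ Yhat B (e m B (B.1.mkQ x))}

open Classical in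
/-- The aggregation step: flip the coordinate `x` of `Y` if and only if `φ(x)` is more than half the
number of projections. -/
def aggregate (e : CosetIndexing) {m : ℕ} (Y : Word m) (Yhat : Line m → Word (m - 1)) : Word m :=
  fun x => Y x + if (Nat.card (Line m) : ℝ) / 2 < (disagreements e Y Yhat x : ℝ) then 1 else 0

open Classical in
/-- At most `M` rounds of `Y ← F Y`, stopping early if `F Y = Y`. -/
def iterateUntilFixed {α : Type} (F : α → α) : ℕ → α → α
  | 0, Y => Y
  | M + 1, Y => if Y = F Y then Y else iterateUntilFixed F M (F Y)

/-- `D n` is, for every `n`, a maximum-likelihood decoder of the first-order code `RM(n,1)`: it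
returns a codeword at minimum Hamming distance from its input. Ties are broken in any way. -/
def IsFirstOrderML (D : ∀ n : ℕ, Word n → Word n) : Prop :=
  ∀ (n : ℕ) (y : Word n), D n y ∈ RM n 1 ∧
    ∀ c ∈ RM n 1, hammingDist y (D n y) ≤ hammingDist y c

/-- The RPA decoder of `RM(m,r)` with one-dimensional projection subspaces and at most `M`
iterations in each recursive call. For `r = 1` it is the given first-order decoder `D`; the case
`r = 0` is never reached from `r ≥ 1` and carries no meaning. -/
def rpa (D : ∀ n : ℕ, Word n → Word n) (e : CosetIndexing) (M : ℕ) :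
    (r m : ℕ) → Word m → Word m
  | 0, _, Y => Y
  | 1, m, Y => D m Y
  | r + 2, m, Y =>
      iterateUntilFixed
        (fun Z => aggregate e Z (fun B => rpa D e M (r + 1) (m - 1) (project e Z B))) M Y

/-- The noise of the binary symmetric channel with crossover probability `p`: i.i.d. coordinates,
each equal to `1` with probability `p` and to `0` with probability `1 - p`. -/
def noise (p : unitInterval) (m : ℕ) : Measure (Word m) :=
  Measure.pi fun _ => bernoulliMeasure (1 : ZMod 2) 0 p

/-- The error probability of the decoder `dec` when the codeword `c` is transmitted. -/
def errProbOf (p : unitInterval) {m : ℕ} (dec : Word m → Word m) (c : Word m) : ℝ :=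
  (noise p m).real {ν | dec (c + ν) ≠ c}

/-- The error probability of the decoder `dec` for the code `RM(m,r)`: the transmitted codeword is
uniformly distributed on the code and independent of the noise. -/
def errProb (p : unitInterval) (m r : ℕ) (dec : Word m → Word m) : ℝ :=
  ((uniformOn (RM m r)).prod (noise p m)).real {x | dec (x.1 + x.2) ≠ x.1}

/-- The crossover probability `(1 - (1 - 2p)^(2^(r-2))) / 2`, for `r ≥ 2`. -/
def pbar (p : ℝ) (r : ℕ) : ℝ := (1 - (1 - 2 * p) ^ (2 ^ (r - 2))) / 2

/-- The function `η(α) = (1 - 4α(1 - α)) / 2`. -/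
def eta (α : ℝ) : ℝ := (1 - 4 * α * (1 - α)) / 2

end RPA

end

/-!
The decoder is analysed one round at a time: under two events on the noise, the first round already
returns the transmitted codeword, which is a fixed point of all later rounds.

The projections of a codeword `c` of `RM(m,r)` are codewords of `RM(m-1,r-1)`, because they are
derivatives of a polynomial (`derivative_mem_RM`). Suppose that every projection of the noisy word
is decoded to the projection of `c`. Then the number of disagreements at `x` is the number of
coordinates `y` with `ν y ≠ ν x`, by the bijection between lines and nonzero vectors. So the
majority vote flips exactly the corrupted coordinates as soon as the noise `ν` has weight less than
`2^m / 2` (`aggregate_of_correct`).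

A decoding error therefore forces either noise of weight at least `2^m / 2`, or an error in one of
the `2^m - 1` projected decoders. The first event is controlled by a Chernoff bound (`noise_tail`).
The second is a decoding error of the same kind, one level down, since projected noise is i.i.d.
again (`map_project_noise`) with crossover probability `2p(1 - p)`, which replaces `1 - 2p` by its
square. At the bottom, a maximum-likelihood error for a first-order code means that half of the
support of some nonzero affine function is flipped; there are at most `2^(m+1)` such functions and
their supports have at least `2^m / 2` elements (`errProbOf_firstOrder_le`). Induction on the order
gives the bound `2 N^r exp(-N (1 - 2p)^(2^r) / 2^(r+1))` with `N = 2^m` (`errProbOf_rpa_le`), for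
every codeword. It implies the claimed one since `(2 η(pbar))^2 = (1 - 2p)^(2^r)`, and it passes
to the average over codewords.
-/

namespace RPA

/-! ### Lines and projections in coordinates -/

lemma ZMod2_cases (a : ZMod 2) : a = 0 ∨ a = 1 := by
  fin_cases a
  · left; rfl
  · right; rfl

/-- The one-dimensional subspace `{0, b}` spanned by a nonzero vector `b`. -/
def lineOf {m : ℕ} (b : {b : Cube m // b ≠ 0}) : Line m :=
  ⟨Submodule.span (ZMod 2) {b.1}, finrank_span_singleton b.2⟩

lemma mem_lineOf {m : ℕ} (b : {b : Cube m // b ≠ 0}) (z : Cube m) :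
    z ∈ (lineOf b).1 ↔ z = 0 ∨ z = b.1 := by
  simp only [lineOf, Submodule.mem_span_singleton]
  constructor
  · rintro ⟨a, rfl⟩
    rcases ZMod2_cases a with rfl | rfl
    · exact Or.inl (zero_smul _ _)
    · exact Or.inr (one_smul _ _)
  · rintro (rfl | rfl)
    · exact ⟨0, by simp⟩
    · exact ⟨1, by simp⟩

lemma lineOf_bijective (m : ℕ) : Function.Bijective (lineOf (m := m)) := by
  constructor
  · intro b b' h
    have hb : b.1 ∈ (lineOf b').1 := h ▸ (mem_lineOf b _).2 (Or.inr rfl)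
    rcases (mem_lineOf b' _).1 hb with h0 | h1
    · exact absurd h0 b.2
    · exact Subtype.ext h1
  · rintro ⟨B, hB⟩
    obtain ⟨⟨v, hv⟩, hv0, hspan⟩ := finrank_eq_one_iff'.1 hB
    have hv0' : v ≠ 0 := fun h => hv0 (Subtype.ext h)
    refine ⟨⟨v, hv0'⟩, Subtype.ext (le_antisymm ?_ ?_)⟩
    · exact (Submodule.span_singleton_le_iff_mem _ _).2 hv
    · intro w hw
      obtain ⟨c, hc⟩ := hspan ⟨w, hw⟩
      exact Submodule.mem_span_singleton.2 ⟨c, congrArg Subtype.val hc⟩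

lemma card_line (m : ℕ) : Nat.card (Line m) + 1 = 2 ^ m := by
  classical
  rw [← Nat.card_congr (Equiv.ofBijective _ (lineOf_bijective m)), Nat.card_eq_fintype_card,
    Fintype.card_subtype_compl, Fintype.card_subtype_eq]
  simp only [Fintype.card_pi, ZMod.card, Finset.prod_const, Finset.card_univ, Fintype.card_fin]
  exact Nat.sub_add_cancel Nat.one_le_two_pow

lemma mkQ_lineOf_eq_iff {m : ℕ} (b : {b : Cube m // b ≠ 0}) (z x : Cube m) :
    (lineOf b).1.mkQ z = (lineOf b).1.mkQ x ↔ z = x ∨ z = x + b.1 := by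
  rw [Submodule.mkQ_apply, Submodule.mkQ_apply, Submodule.Quotient.eq, mem_lineOf,
    sub_eq_zero, sub_eq_iff_eq_add, add_comm b.1]

lemma cosetSum_lineOf {m : ℕ} (Y : Word m) (b : {b : Cube m // b ≠ 0}) (x : Cube m) :
    cosetSum Y (lineOf b) ((lineOf b).1.mkQ x) = Y x + Y (x + b.1) := by
  classical
  have hx : x ≠ x + b.1 := fun h => b.2 (by simpa using h.symm)
  rw [cosetSum, ← Finset.sum_pair hx]
  refine Finset.sum_congr ?_ fun _ _ => rfl
  ext z
  simp [-Submodule.mkQ_apply, mkQ_lineOf_eq_iff]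

/-- A linear choice of representatives: `s t` lies in the coset with index `t`. -/
lemma exists_section (e : CosetIndexing) {m : ℕ} (B : Line m) :
    ∃ s : Cube (m - 1) →ₗ[ZMod 2] Cube m, ∀ t, B.1.mkQ (s t) = (e m B).symm t := by
  obtain ⟨g, hg⟩ := B.1.mkQ.exists_rightInverse_of_surjective B.1.range_mkQ
  refine ⟨g ∘ₗ (e m B).symm.toLinearMap, fun t => ?_⟩
  exact LinearMap.congr_fun hg ((e m B).symm t)

lemma project_eq (e : CosetIndexing) {m : ℕ} (Y : Word m) (b : {b : Cube m // b ≠ 0})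
    {s : Cube (m - 1) → Cube m}
    (hs : ∀ t, (lineOf b).1.mkQ (s t) = (e m (lineOf b)).symm t) (t : Cube (m - 1)) :
    project e Y (lineOf b) t = Y (s t) + Y (s t + b.1) := by
  rw [project, ← hs, cosetSum_lineOf]

lemma project_add (e : CosetIndexing) {m : ℕ} (Y Z : Word m) (B : Line m) :
    project e (Y + Z) B = project e Y B + project e Z B := by
  funext t
  simp [project, cosetSum, Finset.sum_add_distrib]

/-! ### Reed-Muller codes -/

lemma add_mem_RM {m r : ℕ} {v w : Word m} (hv : v ∈ RM m r) (hw : w ∈ RM m r) :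
    v + w ∈ RM m r := by
  obtain ⟨f, hf, rfl⟩ := hv
  obtain ⟨g, hg, rfl⟩ := hw
  exact ⟨f + g, (MvPolynomial.totalDegree_add f g).trans (max_le hf hg), by funext z; simp⟩

lemma zero_mem_RM (m r : ℕ) : (0 : Word m) ∈ RM m r :=
  ⟨0, by simp, by funext z; simp⟩

lemma mul_mem_RM {m a b : ℕ} {v w : Word m} (hv : v ∈ RM m a) (hw : w ∈ RM m b) :
    v * w ∈ RM m (a + b) := by
  obtain ⟨f, hf, rfl⟩ := hv
  obtain ⟨g, hg, rfl⟩ := hw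
  exact ⟨f * g, (MvPolynomial.totalDegree_mul f g).trans (add_le_add hf hg), by funext z; simp⟩

lemma RM_mono {m a b : ℕ} (h : a ≤ b) : RM m a ⊆ RM m b := by
  rintro _ ⟨f, hf, rfl⟩
  exact ⟨f, hf.trans h, rfl⟩

lemma const_mem_RM (m r : ℕ) (a : ZMod 2) : (fun _ => a : Word m) ∈ RM m r :=
  ⟨MvPolynomial.C a, by simp, by funext z; simp⟩

lemma sum_mem_RM {ι : Type*} {m r : ℕ} (S : Finset ι) (w : ι → Word m)
    (h : ∀ i ∈ S, w i ∈ RM m r) : ∑ i ∈ S, w i ∈ RM m r :=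
  Finset.sum_induction w (· ∈ RM m r) (fun _ _ => add_mem_RM) (zero_mem_RM m r) h

lemma linearMap_apply_eq_sum {n : ℕ} (l : Cube n →ₗ[ZMod 2] ZMod 2) (t : Cube n) :
    l t = ∑ i, t i * l (Pi.single i 1) := by
  rw [LinearMap.pi_apply_eq_sum_univ l t]
  refine Finset.sum_congr rfl fun i _ => ?_
  rw [smul_eq_mul]
  congr 2
  funext j
  simp [Pi.single_apply, eq_comm]

lemma linearMap_mem_RM {n : ℕ} (l : Cube n →ₗ[ZMod 2] ZMod 2) : (fun t => l t) ∈ RM n 1 := by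
  have : (fun t => l t) = ∑ i, fun t : Cube n => t i * l (Pi.single i 1) := by
    funext t
    rw [linearMap_apply_eq_sum l t, Finset.sum_apply]
  rw [this]
  refine sum_mem_RM _ _ fun i _ => ?_
  exact mul_mem_RM (a := 1) (b := 0) ⟨MvPolynomial.X i, by simp, by funext z; simp⟩
    (const_mem_RM n 0 _)

/-- The product of `k` affine functions changes by a polynomial of degree less than `k` when each
factor is changed by a constant. For `k = 0` there is no change at all. -/
lemma prod_affine_mem_RM {n : ℕ} (L : Multiset ((Cube n →ₗ[ZMod 2] ZMod 2) × ZMod 2)) :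
    (fun t => (L.map fun p => p.1 t).prod) ∈ RM n L.card ∧
    ∀ k, L.card ≤ k + 1 →
      (fun t => (L.map fun p => p.1 t).prod + (L.map fun p => p.1 t + p.2).prod) ∈ RM n k := by
  induction L using Multiset.induction_on with
  | empty =>
    refine ⟨const_mem_RM n _ 1, fun k _ => ?_⟩
    have : (fun _ => 0 : Word n) ∈ RM n k := const_mem_RM n k 0
    convert this using 2
    simp [CharTwo.add_self_eq_zero]
  | cons p L ih =>
    obtain ⟨ih1, ih2⟩ := ih
    have h1 : (fun t => p.1 t * (L.map fun p => p.1 t).prod) ∈ RM n (1 + L.card) :=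
      mul_mem_RM (linearMap_mem_RM p.1) ih1
    refine ⟨by simpa [add_comm] using h1, fun k hk => ?_⟩
    rw [Multiset.card_cons] at hk
    have hk' : L.card ≤ k := by omega
    have hD : (fun t => p.2 * (L.map fun p => p.1 t + p.2).prod) ∈ RM n (0 + k) := by
      refine mul_mem_RM (const_mem_RM n 0 p.2) ?_
      have := add_mem_RM (ih2 k (by omega)) (RM_mono hk' ih1)
      convert this using 1
      funext t
      simp only [Pi.add_apply]
      rw [add_right_comm, CharTwo.add_self_eq_zero, zero_add]
    have hE : (fun t => p.1 t * ((L.map fun p => p.1 t).prod +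
        (L.map fun p => p.1 t + p.2).prod)) ∈ RM n k := by
      rcases k with _ | k
      · have hL : L = 0 := Multiset.card_eq_zero.1 (by omega)
        subst hL
        have : (fun _ => 0 : Word n) ∈ RM n 0 := const_mem_RM n 0 0
        convert this using 2
        simp [CharTwo.add_self_eq_zero]
      · rw [add_comm k 1]
        exact mul_mem_RM (linearMap_mem_RM p.1) (ih2 k (by omega))
    rw [zero_add] at hD
    convert add_mem_RM hE hD using 1
    funext t
    simp only [Multiset.map_cons, Multiset.prod_cons, Pi.add_apply]
    ring

/-- The derivative of a Reed-Muller codeword in the direction `b`, restricted along a linear map,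
has lower degree. -/
lemma derivative_mem_RM {n m r : ℕ} (s : Cube n →ₗ[ZMod 2] Cube m) (b : Cube m) {c : Word m}
    (hc : c ∈ RM m (r + 1)) : (fun t => c (s t) + c (s t + b)) ∈ RM n r := by
  obtain ⟨f, hf, rfl⟩ := hc
  have : (fun t => MvPolynomial.eval (s t) f + MvPolynomial.eval (s t + b) f) =
      ∑ d ∈ f.support, fun t => f.coeff d * (∏ i, (s t i) ^ d i + ∏ i, (s t i + b i) ^ d i) := by
    funext t
    simp only [MvPolynomial.eval_eq', Finset.sum_apply, mul_add, Finset.sum_add_distrib,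
      Pi.add_apply]
  rw [this]
  refine sum_mem_RM _ _ fun d hd => ?_
  rw [← zero_add r]
  refine mul_mem_RM (const_mem_RM n 0 _) ?_
  have hprod (g : Fin m → ZMod 2) :
      ((Finsupp.toMultiset d).map g).prod = ∏ i, g i ^ d i := by
    rw [Finsupp.toMultiset_map, Finsupp.prod_toMultiset,
      Finsupp.prod_mapDomain_index (by simp) (by simp [pow_add]),
      Finsupp.prod_fintype _ _ (by simp)]
  have hdeg : (Finsupp.toMultiset d).card ≤ r + 1 := by
    rw [Finsupp.card_toMultiset]
    exact (MvPolynomial.le_totalDegree hd).trans hf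
  have := (prod_affine_mem_RM ((Finsupp.toMultiset d).map fun i =>
    ((LinearMap.proj i ∘ₗ s : Cube n →ₗ[ZMod 2] ZMod 2), b i))).2 r (by simpa using hdeg)
  convert this using 1
  funext t
  simp only [Multiset.map_map, Function.comp_def, LinearMap.comp_apply, LinearMap.proj_apply,
    hprod]

lemma project_mem_RM (e : CosetIndexing) {m r : ℕ} (B : Line m) {c : Word m}
    (hc : c ∈ RM m (r + 1)) : project e c B ∈ RM (m - 1) r := by
  obtain ⟨b, rfl⟩ := (lineOf_bijective m).2 B
  obtain ⟨s, hs⟩ := exists_section e (lineOf b)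
  rw [funext (project_eq e c b hs)]
  exact derivative_mem_RM s b.1 hc

lemma RM_zero_const {m : ℕ} {c : Word m} (hc : c ∈ RM m 0) (x y : Cube m) : c x = c y := by
  obtain ⟨f, hf, rfl⟩ := hc
  rw [MvPolynomial.totalDegree_eq_zero_iff_eq_C.1 (Nat.le_zero.1 hf)]
  simp

lemma RM_one_derivative {m : ℕ} {c : Word m} (hc : c ∈ RM m 1) (x y b : Cube m) :
    c x + c (x + b) = c y + c (y + b) :=
  RM_zero_const (derivative_mem_RM LinearMap.id b hc) x y

/-- First-order codewords are affine functions, so there are at most `2^(m+1)` of them. -/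
lemma card_RM_one_le (m : ℕ) : (RM m 1).ncard ≤ 2 * 2 ^ m := by
  classical
  have hsub : RM m 1 ⊆ (fun p : ZMod 2 × Cube m => fun z => (∑ i, z i * p.2 i) + p.1) ''
      Set.univ := by
    intro c hc
    let l : Cube m →+ ZMod 2 := AddMonoidHom.mk' (fun x => c x + c 0) fun x y => by
      have h := RM_one_derivative hc x 0 y
      rw [zero_add] at h
      have h2 : c 0 + c 0 = 0 := CharTwo.add_self_eq_zero _
      have h3 : c x + c x = 0 := CharTwo.add_self_eq_zero _
      linear_combination h - h3
    have hl : ∀ x, c x = l.toZModLinearMap 2 x + c 0 := fun x => by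
      change c x = c x + c 0 + c 0
      rw [add_assoc, CharTwo.add_self_eq_zero, add_zero]
    refine ⟨(c 0, fun i => l (Pi.single i 1)), Set.mem_univ _, ?_⟩
    funext z
    rw [hl z, linearMap_apply_eq_sum]
    rfl
  refine (Set.ncard_le_ncard hsub (Set.toFinite _)).trans
    ((Set.ncard_image_le (Set.toFinite _)).trans ?_)
  rw [Set.ncard_univ, Nat.card_eq_fintype_card]
  simp

/-- A nonzero affine function takes the value `1` on at least half of its arguments. -/
lemma le_two_mul_weight {m : ℕ} {c : Word m} (hc : c ∈ RM m 1) (h0 : c ≠ 0) :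
    2 ^ m ≤ 2 * (Finset.univ.filter fun z => c z = 1).card := by
  classical
  have hcard : Fintype.card (Cube m) = 2 ^ m := by simp
  have hsplit := Finset.card_filter_add_card_filter_not (s := (Finset.univ : Finset (Cube m)))
    (fun z => c z = 1)
  rw [Finset.card_univ, hcard] at hsplit
  suffices (Finset.univ.filter fun z => ¬ c z = 1).card ≤
      (Finset.univ.filter fun z => c z = 1).card by omega
  by_cases hb : ∃ b, c 0 + c b = 1
  · obtain ⟨b, hb⟩ := hb
    refine Finset.card_le_card_of_injOn (fun z => z + b) ?_ fun _ _ _ _ h => add_right_cancel h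
    intro z hz
    simp only [Finset.coe_filter, Finset.mem_univ, true_and, Set.mem_ofPred_eq] at hz ⊢
    have h := RM_one_derivative hc z 0 b
    rw [(ZMod2_cases (c z)).resolve_right hz, zero_add, zero_add, hb] at h
    exact h
  · push Not at hb
    have hconst : ∀ b, c b = c 0 := fun b => by
      have h := (ZMod2_cases _).resolve_right (hb b)
      exact (CharTwo.add_eq_zero.1 h).symm
    have h1 : c 0 = 1 := by
      refine (ZMod2_cases _).resolve_left fun h => h0 ?_
      funext z
      rw [hconst z, h]; rfl
    rw [Finset.filter_false_of_mem (fun z _ => by simp [hconst z, h1])]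
    simp

/-! ### Aggregation under correct projections -/

lemma disagreements_of_correct (e : CosetIndexing) {m : ℕ} (c ν : Word m)
    {Yhat : Line m → Word (m - 1)} (h : ∀ B, Yhat B = project e c B) (x : Cube m) :
    disagreements e (c + ν) Yhat x = (Finset.univ.filter fun y => ν y ≠ ν x).card := by
  classical
  have key (B : Line m) : cosetSum (c + ν) B (B.1.mkQ x) ≠ Yhat B (e m B (B.1.mkQ x)) ↔
      cosetSum ν B (B.1.mkQ x) ≠ 0 := by
    rw [h, project, LinearEquiv.symm_apply_apply]
    have : cosetSum (c + ν) B (B.1.mkQ x) =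
        cosetSum c B (B.1.mkQ x) + cosetSum ν B (B.1.mkQ x) := by
      simp only [cosetSum, Pi.add_apply, Finset.sum_add_distrib]
    rw [this, Ne, add_eq_left]
  have key' (b : {b : Cube m // b ≠ 0}) :
      cosetSum (c + ν) (lineOf b) ((lineOf b).1.mkQ x) ≠
        Yhat (lineOf b) (e m (lineOf b) ((lineOf b).1.mkQ x)) ↔ ν (x + b.1) ≠ ν x := by
    rw [key, cosetSum_lineOf, Ne, CharTwo.add_eq_zero, eq_comm]
  have hcancel (y : Cube m) : x + (x + y) = y := by
    funext i
    exact CharTwo.add_cancel_left (x i) (y i)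
  have hne (y : {y : Cube m // ν y ≠ ν x}) : x + y.1 ≠ 0 := fun h0 =>
    y.2 (by rw [← hcancel y.1, h0, add_zero])
  rw [disagreements, ← Fintype.card_subtype, ← Nat.card_eq_fintype_card]
  refine (Nat.card_eq_of_bijective
    (fun y : {y : Cube m // ν y ≠ ν x} => (⟨lineOf ⟨x + y.1, hne y⟩, ?_⟩ :
      {B : Line m // cosetSum (c + ν) B (B.1.mkQ x) ≠ Yhat B (e m B (B.1.mkQ x))})) ⟨?_, ?_⟩).symm
  · rw [key']
    simpa only [hcancel] using y.2
  · intro y y' hyy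
    have h1 := (lineOf_bijective m).1 (congrArg Subtype.val hyy)
    exact Subtype.ext (add_left_cancel (congrArg Subtype.val h1))
  · rintro ⟨B, hB⟩
    obtain ⟨b, rfl⟩ := (lineOf_bijective m).2 B
    refine ⟨⟨x + b.1, (key' b).1 hB⟩, Subtype.ext ?_⟩
    exact congrArg lineOf (Subtype.ext (hcancel b.1))

/-- If all projections are decoded correctly and the noise affects less than half of the
coordinates, one round of aggregation removes the noise. -/
lemma aggregate_of_correct (e : CosetIndexing) {m : ℕ} (c ν : Word m)
    {Yhat : Line m → Word (m - 1)} (h : ∀ B, Yhat B = project e c B)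
    (hν : 2 * (Finset.univ.filter fun z => ν z = 1).card < 2 ^ m) :
    aggregate e (c + ν) Yhat = c := by
  classical
  have hcard : (Nat.card (Line m) : ℝ) + 1 = 2 ^ m := by exact_mod_cast card_line m
  have hsplit := Finset.card_filter_add_card_filter_not (s := (Finset.univ : Finset (Cube m)))
    (fun z => ν z = 1)
  have hcube : (Finset.univ : Finset (Cube m)).card = 2 ^ m := by simp
  rw [hcube] at hsplit
  have hν' : (2 : ℝ) * (Finset.univ.filter fun z => ν z = 1).card + 1 ≤ 2 ^ m := by
    exact_mod_cast hν
  have hsplit' : ((Finset.univ.filter fun z => ν z = 1).card : ℝ) +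
      (Finset.univ.filter fun z => ¬ ν z = 1).card = 2 ^ m := by exact_mod_cast hsplit
  funext x
  rw [aggregate, disagreements_of_correct e c ν h]
  rcases ZMod2_cases (ν x) with hx | hx
  · have hfil : (Finset.univ.filter fun y => ν y ≠ ν x) =
        Finset.univ.filter fun z => ν z = 1 := by
      refine Finset.filter_congr fun y _ => ?_
      rcases ZMod2_cases (ν y) with hy | hy <;> simp [hx, hy]
    rw [hfil, if_neg (by linarith), Pi.add_apply, hx, add_zero, add_zero]
  · have hfil : (Finset.univ.filter fun y => ν y ≠ ν x) =
        Finset.univ.filter fun z => ¬ ν z = 1 := by simp only [hx, Ne]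
    rw [hfil, if_pos (by linarith), Pi.add_apply, hx, add_assoc, CharTwo.add_self_eq_zero,
      add_zero]

lemma iterateUntilFixed_of_fixed {α : Type} (F : α → α) {c : α} (hc : F c = c) (M : ℕ) :
    iterateUntilFixed F M c = c := by
  cases M with
  | zero => rfl
  | succ M => rw [iterateUntilFixed, if_pos hc.symm]

lemma iterateUntilFixed_of_map_eq {α : Type} (F : α → α) {c Y : α} (hY : F Y = c) (hc : F c = c)
    {M : ℕ} (hM : 1 ≤ M) : iterateUntilFixed F M Y = c := by
  obtain ⟨M, rfl⟩ := Nat.exists_eq_add_of_le' hM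
  rw [iterateUntilFixed, hY]
  split_ifs with h
  · exact h
  · exact iterateUntilFixed_of_fixed F hc M

lemma rpa_add_two (D : ∀ n : ℕ, Word n → Word n) (e : CosetIndexing) (M r m : ℕ) (Y : Word m) :
    rpa D e M (r + 2) m Y = iterateUntilFixed
      (fun Z => aggregate e Z (fun B => rpa D e M (r + 1) (m - 1) (project e Z B))) M Y := rfl

/-- Codewords are fixed points of the decoder. -/
lemma rpa_codeword {D : ∀ n : ℕ, Word n → Word n} (hD : IsFirstOrderML D) (e : CosetIndexing)
    (M k m : ℕ) {c : Word m} (hc : c ∈ RM m (k + 1)) : rpa D e M (k + 1) m c = c := by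
  induction k generalizing m with
  | zero =>
    have h := (hD m c).2 c hc
    rw [hammingDist_self, Nat.le_zero, hammingDist_eq_zero] at h
    exact h.symm
  | succ k ih =>
    rw [rpa_add_two]
    refine iterateUntilFixed_of_fixed _ ?_ M
    have := aggregate_of_correct e c 0
      (Yhat := fun B => rpa D e M (k + 1) (m - 1) (project e c B))
      (fun B => ih (m - 1) (project_mem_RM e B hc)) (by simp)
    rwa [add_zero] at this

/-- The decoder can fail only if at least half of the coordinates are flipped or if one of the
projections is decoded incorrectly. -/
lemma rpa_correct {D : ∀ n : ℕ, Word n → Word n} (hD : IsFirstOrderML D) (e : CosetIndexing)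
    {M : ℕ} (hM : 1 ≤ M) {k m : ℕ} {c ν : Word m} (hc : c ∈ RM m (k + 2))
    (hν : 2 * (Finset.univ.filter fun z => ν z = 1).card < 2 ^ m)
    (hproj : ∀ B, rpa D e M (k + 1) (m - 1) (project e c B + project e ν B) = project e c B) :
    rpa D e M (k + 2) m (c + ν) = c := by
  rw [rpa_add_two]
  refine iterateUntilFixed_of_map_eq _ ?_ ?_ hM
  · exact aggregate_of_correct e c ν (fun B => by rw [project_add, hproj]) hν
  · have := aggregate_of_correct e c 0
      (Yhat := fun B => rpa D e M (k + 1) (m - 1) (project e c B))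
      (fun B => rpa_codeword hD e M k (m - 1) (project_mem_RM e B hc)) (by simp)
    rwa [add_zero] at this

/-! ### Noise: tail bound and projections -/

instance (p : unitInterval) (m : ℕ) : IsProbabilityMeasure (noise p m) := by
  unfold noise; infer_instance

/-- Chernoff bound: half of the coordinates in a set `S` are flipped with exponentially small
probability. -/
lemma noise_tail (p : unitInterval) (hp0 : 0 < (p : ℝ)) (hp : (p : ℝ) < 1 / 2) {m : ℕ}
    (S : Finset (Cube m)) :
    (noise p m).real {ν | S.card ≤ 2 * (S.filter fun z => ν z = 1).card} ≤
      Real.exp (-(S.card * (1 - 2 * (p : ℝ)) ^ 2 / 2)) := by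
  classical
  -- The minimizer of `p θ + (1 - p) / θ`, with minimum `√(1 - (1 - 2p)²)`.
  set θ : ℝ := √((1 - p) / p) with hθ
  have hθ1 : 1 ≤ θ := by
    rw [hθ, Real.one_le_sqrt, one_le_div hp0]; linarith
  have hθ0 : 0 < θ := by linarith
  have hθsq : θ ^ 2 = (1 - p) / p := Real.sq_sqrt (div_nonneg (by linarith) hp0.le)
  let g : Cube m → ZMod 2 → ℝ := fun z a => if z ∈ S then (if a = 1 then θ else θ⁻¹) else 1
  have hg (ν : Word m) : ∏ z, g z (ν z) =
      θ ^ (S.filter fun z => ν z = 1).card * θ⁻¹ ^ (S.filter fun z => ¬ ν z = 1).card := by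
    rw [Finset.prod_ite, Finset.prod_const_one, mul_one, Finset.filter_mem_eq_inter,
      Finset.univ_inter, Finset.prod_ite, Finset.prod_const, Finset.prod_const]
  have hind (ν : Word m) :
      Set.indicator {ν : Word m | S.card ≤ 2 * (S.filter fun z => ν z = 1).card} 1 ν ≤
        ∏ z, g z (ν z) := by
    rw [hg]
    by_cases hν : ν ∈ {ν : Word m | S.card ≤ 2 * (S.filter fun z => ν z = 1).card}
    · rw [Set.indicator_of_mem hν, Pi.one_apply, inv_pow, ← div_eq_mul_inv,
        one_le_div (by positivity)]
      refine pow_le_pow_right₀ hθ1 ?_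
      have := Finset.card_filter_add_card_filter_not (s := S) (fun z => ν z = 1)
      have hν' : S.card ≤ 2 * (S.filter fun z => ν z = 1).card := hν
      omega
    · rw [Set.indicator_of_notMem hν]
      positivity
  have hsq : (p * θ + (1 - p) * θ⁻¹) ^ 2 = 1 - (1 - 2 * (p : ℝ)) ^ 2 := by
    have h1 : (1 - (p : ℝ)) = p * θ ^ 2 := by rw [hθsq]; field_simp
    have h2 : (1 - (p : ℝ)) * θ⁻¹ = p * θ := by rw [h1]; field_simp
    rw [h2]
    linear_combination (-4 * (p : ℝ)) * h1
  have hbase : p * θ + (1 - p) * θ⁻¹ ≤ Real.exp (-((1 - 2 * (p : ℝ)) ^ 2 / 2)) := by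
    refine le_of_sq_le_sq ?_ (Real.exp_pos _).le
    rw [hsq, ← Real.exp_nat_mul]
    refine (by linarith [Real.add_one_le_exp (-(1 - 2 * (p : ℝ)) ^ 2)] :
      1 - (1 - 2 * (p : ℝ)) ^ 2 ≤ Real.exp (-(1 - 2 * (p : ℝ)) ^ 2)).trans (le_of_eq ?_)
    congr 1
    push_cast
    ring
  calc (noise p m).real {ν | S.card ≤ 2 * (S.filter fun z => ν z = 1).card}
      = ∫ ν, Set.indicator {ν : Word m | S.card ≤ 2 * (S.filter fun z => ν z = 1).card} 1 ν
          ∂(noise p m) := (integral_indicator_one (Set.toFinite _).measurableSet).symm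
    _ ≤ ∫ ν, ∏ z, g z (ν z) ∂(noise p m) :=
        integral_mono Integrable.of_finite Integrable.of_finite hind
    _ = ∏ z, ∫ a, g z a ∂(bernoulliMeasure (1 : ZMod 2) 0 p) := by
        rw [noise, integral_fintype_prod_eq_prod]
    _ = (p * θ + (1 - p) * θ⁻¹) ^ S.card := by
        have : ∀ z, ∫ a, g z a ∂(bernoulliMeasure (1 : ZMod 2) 0 p) =
            if z ∈ S then p * θ + (1 - p) * θ⁻¹ else 1 := by
          intro z
          rw [integral_bernoulliMeasure]
          by_cases hz : z ∈ S <;> simp [g, hz]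
        simp only [this]
        rw [Finset.prod_ite, Finset.prod_const_one, mul_one, Finset.filter_mem_eq_inter,
          Finset.univ_inter, Finset.prod_const]
    _ ≤ Real.exp (-((1 - 2 * (p : ℝ)) ^ 2 / 2)) ^ S.card :=
        pow_le_pow_left₀ (add_nonneg (by positivity)
          (mul_nonneg (by linarith) (by positivity))) hbase _
    _ = Real.exp (-(S.card * (1 - 2 * (p : ℝ)) ^ 2 / 2)) := by
        rw [← Real.exp_nat_mul]; congr 1; ring

/-- The crossover probability of the sum of two independent noise bits. -/
def doubled (p : unitInterval) : unitInterval :=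
  ⟨2 * p * (1 - p), mul_nonneg (mul_nonneg zero_le_two p.2.1) (by linarith [p.2.2]), by
    nlinarith [sq_nonneg (1 - 2 * (p : ℝ))]⟩

lemma coe_doubled (p : unitInterval) : (doubled p : ℝ) = 2 * p * (1 - p) := rfl

lemma map_add_bernoulli (p : unitInterval) :
    ((bernoulliMeasure (1 : ZMod 2) 0 p).prod (bernoulliMeasure (1 : ZMod 2) 0 p)).map
      (fun a => a.1 + a.2) = bernoulliMeasure (1 : ZMod 2) 0 (doubled p) := by
  have hm : Measurable fun a : ZMod 2 × ZMod 2 => a.1 + a.2 := measurable_of_finite _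
  have := Measure.isProbabilityMeasure_map (μ := (bernoulliMeasure (1 : ZMod 2) 0 p).prod
    (bernoulliMeasure (1 : ZMod 2) 0 p)) hm.aemeasurable
  refine Measure.ext fun s hs => ?_
  rw [← measureReal_eq_measureReal_iff, ← integral_indicator_one hs, ← integral_indicator_one hs,
    integral_map hm.aemeasurable (measurable_of_finite _).aestronglyMeasurable,
    integral_prod _ Integrable.of_finite]
  simp only [integral_bernoulliMeasure, smul_eq_mul, coe_doubled, add_zero, zero_add,
    CharTwo.add_self_eq_zero]
  ring

/-- A projection of i.i.d. noise is i.i.d. noise, with the crossover probability `2p(1 - p)`. -/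
lemma map_project_noise (e : CosetIndexing) (p : unitInterval) {m : ℕ} (B : Line m) :
    (noise p m).map (fun ν => project e ν B) = noise (doubled p) (m - 1) := by
  classical
  obtain ⟨b, rfl⟩ := (lineOf_bijective m).2 B
  obtain ⟨s, hs⟩ := exists_section e (lineOf b)
  have hinj (t t' : Cube (m - 1)) (h : s t = s t' ∨ s t = s t' + b.1) : t = t' := by
    rw [← mkQ_lineOf_eq_iff, hs, hs] at h
    exact (e m (lineOf b)).symm.injective h
  have hb : ∀ x : Cube m, x ≠ x + b.1 := fun x h => b.2 (by simpa using h.symm)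
  have hbij : Function.Bijective (Sum.elim (fun t => s t) (fun t => s t + b.1)) := by
    constructor
    · rintro (t | t) (t' | t') h
      · exact congrArg Sum.inl (hinj t t' (Or.inl h))
      · have h' : s t = s t' + b.1 := h
        obtain rfl := hinj t t' (Or.inr h')
        exact absurd h' (hb _)
      · have h' : s t + b.1 = s t' := h
        obtain rfl := hinj t' t (Or.inr h'.symm)
        exact absurd h'.symm (hb _)
      · exact congrArg Sum.inr (hinj t t' (Or.inl (add_right_cancel h)))
    · intro x
      have hx : (lineOf b).1.mkQ x =
          (lineOf b).1.mkQ (s (e m (lineOf b) ((lineOf b).1.mkQ x))) := by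
        rw [hs, LinearEquiv.symm_apply_apply]
      rcases (mkQ_lineOf_eq_iff b _ _).1 hx with h | h
      · exact ⟨Sum.inl _, h.symm⟩
      · exact ⟨Sum.inr _, h.symm⟩
  let σ := Equiv.ofBijective _ hbij
  let μ := bernoulliMeasure (1 : ZMod 2) 0 p
  have h1 : MeasurePreserving (MeasurableEquiv.piCongrLeft (fun _ : Cube m => ZMod 2) σ).symm
      (Measure.pi fun _ => μ) (Measure.pi fun _ => μ) :=
    (measurePreserving_piCongrLeft (fun _ : Cube m => μ) σ).symm
  have h2 := measurePreserving_sumPiEquivProdPi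
    (fun _ : Cube (m - 1) ⊕ Cube (m - 1) => μ)
  have h3 := (measurePreserving_arrowProdEquivProdArrow (ZMod 2) (ZMod 2) (Cube (m - 1))
    (fun _ => μ) (fun _ => μ)).symm
  have h4 : (Measure.pi fun _ : Cube (m - 1) => μ.prod μ).map (fun x t => (x t).1 + (x t).2) =
      noise (doubled p) (m - 1) := by
    rw [Measure.pi_map_pi (f := fun _ (a : ZMod 2 × ZMod 2) => a.1 + a.2)
      (fun _ => (measurable_of_finite _).aemeasurable)]
    simp only [μ, map_add_bernoulli]
    rfl
  have h5 := h3.comp (h2.comp h1)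
  rw [← h4, ← h5.map_eq, Measure.map_map (measurable_of_finite _) h5.measurable, noise]
  congr 1
  funext ν t
  rw [project_eq e ν b hs]
  rfl

/-! ### Error probabilities -/

/-- If a maximum-likelihood decoder fails, at least half of the support of some nonzero codeword is
flipped. -/
lemma exists_of_ml_error {D : ∀ n : ℕ, Word n → Word n} (hD : IsFirstOrderML D) {m : ℕ}
    {c ν : Word m} (hc : c ∈ RM m 1) (h : D m (c + ν) ≠ c) :
    ∃ d ∈ RM m 1, d ≠ 0 ∧ (Finset.univ.filter fun z => d z = 1).card ≤
      2 * ((Finset.univ.filter fun z => d z = 1).filter fun z => ν z = 1).card := by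
  classical
  obtain ⟨hmem, hmin⟩ := hD m (c + ν)
  set w := D m (c + ν)
  have hdist : hammingDist (c + ν) w ≤ hammingDist (c + ν) c := hmin c hc
  refine ⟨c + w, add_mem_RM hc hmem, fun h0 => h ?_, ?_⟩
  · funext z
    exact (CharTwo.add_eq_zero.1 (congrFun h0 z)).symm
  set d := c + w with hd
  have e1 : hammingDist (c + ν) w =
      ∑ z, if ν z ≠ d z then 1 else 0 := by
    rw [hammingDist, Finset.card_filter]
    refine Finset.sum_congr rfl fun z _ => ?_
    have : (c + ν) z ≠ w z ↔ ν z ≠ d z := by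
      rw [hd, Pi.add_apply, Pi.add_apply]
      generalize c z = a, w z = b, ν z = x
      revert a b x; decide
    simp only [this]
  have e2 : hammingDist (c + ν) c = ∑ z, if ν z = 1 then 1 else 0 := by
    rw [hammingDist, Finset.card_filter]
    refine Finset.sum_congr rfl fun z _ => ?_
    have : (c + ν) z ≠ c z ↔ ν z = 1 := by
      rw [Pi.add_apply]
      generalize c z = a, ν z = x
      revert a x; decide
    simp only [this]
  rw [e1, e2] at hdist
  rw [Finset.filter_filter, Finset.card_filter, Finset.card_filter]
  have key : (∑ z, if d z = 1 then 1 else 0) + (∑ z, if ν z = 1 then 1 else 0) =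
      (∑ z, if ν z ≠ d z then 1 else 0) + 2 * ∑ z, if d z = 1 ∧ ν z = 1 then 1 else 0 := by
    rw [← Finset.sum_add_distrib, Finset.mul_sum, ← Finset.sum_add_distrib]
    refine Finset.sum_congr rfl fun z _ => ?_
    rcases ZMod2_cases (d z) with h1 | h1 <;> rcases ZMod2_cases (ν z) with h2 | h2 <;>
      simp [h1, h2]
  omega

/-- Union bound over the at most `2^(m+1)` nonzero codewords, each of weight at least `2^m / 2`. -/
lemma errProbOf_firstOrder_le {D : ∀ n : ℕ, Word n → Word n} (hD : IsFirstOrderML D)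
    (p : unitInterval) (hp0 : 0 < (p : ℝ)) (hp : (p : ℝ) < 1 / 2) {m : ℕ} {c : Word m}
    (hc : c ∈ RM m 1) :
    errProbOf p (D m) c ≤ 2 * 2 ^ m * Real.exp (-(2 ^ m * (1 - 2 * (p : ℝ)) ^ 2 / 4)) := by
  classical
  let A : Finset (Word m) := ((Set.toFinite (RM m 1)).toFinset).filter (· ≠ 0)
  let S : Word m → Finset (Cube m) := fun d => Finset.univ.filter fun z => d z = 1
  let E : Word m → Set (Word m) := fun d =>
    {ν | (S d).card ≤ 2 * ((S d).filter fun z => ν z = 1).card}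
  have hsub : {ν | D m (c + ν) ≠ c} ⊆ ⋃ d ∈ A, E d := by
    intro ν hν
    obtain ⟨d, hd, hd0, h⟩ := exists_of_ml_error hD hc hν
    simp only [Set.mem_iUnion]
    exact ⟨d, by simp [A, hd, hd0], h⟩
  have hA : (A.card : ℝ) ≤ 2 * 2 ^ m := by
    have h1 : A.card ≤ (RM m 1).ncard := by
      rw [Set.ncard_eq_toFinset_card _ (Set.toFinite _)]
      exact Finset.card_filter_le _ _
    exact_mod_cast h1.trans (card_RM_one_le m)
  calc errProbOf p (D m) c ≤ (noise p m).real (⋃ d ∈ A, E d) := measureReal_mono hsub (measure_ne_top _ _)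
    _ ≤ ∑ d ∈ A, (noise p m).real (E d) := measureReal_biUnion_finset_le _ _
    _ ≤ ∑ d ∈ A, Real.exp (-(2 ^ m * (1 - 2 * (p : ℝ)) ^ 2 / 4)) := by
        refine Finset.sum_le_sum fun d hd => (noise_tail p hp0 hp (S d)).trans ?_
        rw [Finset.mem_filter, Set.Finite.mem_toFinset] at hd
        have hw : (2 : ℝ) ^ m ≤ 2 * (S d).card := by exact_mod_cast le_two_mul_weight hd.1 hd.2
        rw [Real.exp_le_exp]
        nlinarith [mul_le_mul_of_nonneg_right hw (sq_nonneg (1 - 2 * (p : ℝ)))]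
    _ = A.card * Real.exp (-(2 ^ m * (1 - 2 * (p : ℝ)) ^ 2 / 4)) := by
        rw [Finset.sum_const, nsmul_eq_mul]
    _ ≤ _ := mul_le_mul_of_nonneg_right hA (Real.exp_pos _).le

lemma noise_project_error (e : CosetIndexing) (p : unitInterval) {m : ℕ} (B : Line m)
    (dec : Word (m - 1) → Word (m - 1)) (c : Word m) :
    (noise p m).real {ν | dec (project e c B + project e ν B) ≠ project e c B} =
      errProbOf (doubled p) dec (project e c B) := by
  rw [errProbOf, ← map_project_noise e p B, map_measureReal_apply (measurable_of_finite _)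
    (Set.toFinite _).measurableSet]
  rfl

/-- One level of the recursion: an error needs heavy noise or an error in one of the
projections. -/
lemma errProbOf_succ_le {D : ∀ n : ℕ, Word n → Word n} (hD : IsFirstOrderML D)
    (e : CosetIndexing) {M : ℕ} (hM : 1 ≤ M) (p : unitInterval) (hp0 : 0 < (p : ℝ))
    (hp : (p : ℝ) < 1 / 2) {k m : ℕ} {c : Word m} (hc : c ∈ RM m (k + 2)) {β : ℝ}
    (hβ : ∀ c' ∈ RM (m - 1) (k + 1), errProbOf (doubled p) (rpa D e M (k + 1) (m - 1)) c' ≤ β) :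
    errProbOf p (rpa D e M (k + 2) m) c ≤
      Real.exp (-(2 ^ m * (1 - 2 * (p : ℝ)) ^ 2 / 2)) + (2 ^ m - 1) * β := by
  classical
  have := Fintype.ofFinite (Line m)
  let E : Line m → Set (Word m) := fun B =>
    {ν | rpa D e M (k + 1) (m - 1) (project e c B + project e ν B) ≠ project e c B}
  let W : Set (Word m) := {ν | (Finset.univ : Finset (Cube m)).card ≤
    2 * (Finset.univ.filter fun z => ν z = 1).card}
  have hcube : (Finset.univ : Finset (Cube m)).card = 2 ^ m := by simp
  have hsub : {ν | rpa D e M (k + 2) m (c + ν) ≠ c} ⊆ W ∪ ⋃ B, E B := by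
    intro ν hν
    by_contra hcon
    rw [Set.mem_union, Set.mem_iUnion, not_or, not_exists] at hcon
    refine hν (rpa_correct hD e hM hc ?_ fun B => not_not.1 (hcon.2 B))
    rw [← hcube]
    exact not_le.1 hcon.1
  have hline : (Fintype.card (Line m) : ℝ) = 2 ^ m - 1 := by
    rw [eq_sub_iff_add_eq, ← Nat.card_eq_fintype_card]
    exact_mod_cast card_line m
  have hW : (noise p m).real W ≤ Real.exp (-(2 ^ m * (1 - 2 * (p : ℝ)) ^ 2 / 2)) := by
    have := noise_tail p hp0 hp (Finset.univ : Finset (Cube m))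
    rw [hcube, Nat.cast_pow, Nat.cast_ofNat] at this
    simpa only [W, hcube] using this
  calc errProbOf p (rpa D e M (k + 2) m) c ≤ (noise p m).real (W ∪ ⋃ B, E B) :=
        measureReal_mono hsub
    _ ≤ (noise p m).real W + ∑ B, (noise p m).real (E B) :=
        (measureReal_union_le _ _).trans
          (add_le_add le_rfl (measureReal_iUnion_fintype_le _))
    _ ≤ Real.exp (-(2 ^ m * (1 - 2 * (p : ℝ)) ^ 2 / 2)) + ∑ _B : Line m, β := by
        refine add_le_add hW (Finset.sum_le_sum fun B _ => ?_)
        rw [noise_project_error]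
        exact hβ _ (project_mem_RM e B hc)
    _ = _ := by rw [Finset.sum_const, nsmul_eq_mul, Finset.card_univ, hline]

/-- The error bound for one fixed codeword. In the induction the length halves and `1 - 2p` is
squared, so the exponent keeps its form; the heavy-noise term is absorbed because `1 - 2p` lies in
`[0, 1]`. -/
lemma errProbOf_rpa_le {D : ∀ n : ℕ, Word n → Word n} (hD : IsFirstOrderML D)
    (e : CosetIndexing) {M : ℕ} (hM : 1 ≤ M) (k : ℕ) : ∀ (p : unitInterval), 0 < (p : ℝ) →
    (p : ℝ) < 1 / 2 → ∀ m, k + 1 ≤ m → ∀ c ∈ RM m (k + 1),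
    errProbOf p (rpa D e M (k + 1) m) c ≤ 2 * ((2 : ℝ) ^ m) ^ (k + 1) *
      Real.exp (-(2 ^ m * (1 - 2 * (p : ℝ)) ^ 2 ^ (k + 1) / 2 ^ (k + 2))) := by
  induction k with
  | zero =>
    intro p hp0 hp m _ c hc
    have h := errProbOf_firstOrder_le hD p hp0 hp hc
    norm_num at h ⊢
    exact h
  | succ k ih =>
    intro p hp0 hp m hkm c hc
    obtain ⟨n, rfl⟩ : ∃ n, m = n + 1 := ⟨m - 1, by omega⟩
    have hq : 1 - 2 * (doubled p : ℝ) = (1 - 2 * (p : ℝ)) ^ 2 := by rw [coe_doubled]; ring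
    have hβ := ih (doubled p) (by rw [coe_doubled]; exact mul_pos (by linarith) (by linarith))
      (by nlinarith [sq_pos_of_pos (by linarith : 0 < 1 - 2 * (p : ℝ))]) n (by omega)
    refine (errProbOf_succ_le hD e hM p hp0 hp hc hβ).trans ?_
    rw [hq, ← pow_mul (1 - 2 * (p : ℝ)) 2, ← pow_succ']
    set q := 1 - 2 * (p : ℝ)
    have hq0 : 0 ≤ q := by simp only [q]; linarith
    have hq1 : q ≤ 1 := by simp only [q]; linarith
    set N : ℝ := 2 ^ (n + 1) with hN
    have hNn : (2 : ℝ) ^ n = N / 2 := by rw [hN, pow_succ]; ring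
    have hN1 : 1 ≤ N := one_le_pow₀ one_le_two
    rw [hNn]
    set x := Real.exp (-(N * q ^ 2 ^ (k + 1 + 1) / 2 ^ (k + 1 + 2))) with hx
    have hx0 : 0 < x := Real.exp_pos _
    have hE1 : Real.exp (-(N / 2 * q ^ 2 ^ (k + 1 + 1) / 2 ^ (k + 2))) = x := by
      rw [hx]; congr 1; rw [show k + 1 + 2 = (k + 2) + 1 by ring, pow_succ]; field_simp; ring
    have hE2 : Real.exp (-(N * q ^ 2 / 2)) ≤ x := by
      rw [hx, Real.exp_le_exp, neg_le_neg_iff]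
      refine div_le_div₀ (by positivity) ?_ two_pos ?_
      · refine mul_le_mul_of_nonneg_left (pow_le_pow_of_le_one hq0 hq1 ?_) (by linarith)
        exact Nat.le_self_pow (by omega) 2
      · exact le_self_pow₀ one_le_two (by omega)
    have hP : 2 * (N / 2) ^ (k + 1) ≤ N ^ (k + 1) := by
      rw [div_pow, mul_div_assoc', div_le_iff₀ (by positivity), mul_comm]
      exact mul_le_mul_of_nonneg_left (le_self_pow₀ one_le_two (by omega)) (by positivity)
    have hN2 : 1 ≤ N ^ (k + 1 + 1) := one_le_pow₀ hN1
    rw [hE1]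
    calc Real.exp (-(N * q ^ 2 / 2)) + (N - 1) * (2 * (N / 2) ^ (k + 1) * x)
        ≤ x + N * (N ^ (k + 1) * x) := by
          refine add_le_add hE2 (mul_le_mul (by linarith) ?_ (by positivity) (by linarith))
          exact mul_le_mul_of_nonneg_right hP hx0.le
      _ = (1 + N ^ (k + 1 + 1)) * x := by ring
      _ ≤ 2 * N ^ (k + 1 + 1) * x := mul_le_mul_of_nonneg_right (by linarith) hx0.le

lemma errProb_le_of_errProbOf_le (p : unitInterval) {m r : ℕ} {dec : Word m → Word m} {β : ℝ}
    (h : ∀ c ∈ RM m r, errProbOf p dec c ≤ β) : errProb p m r dec ≤ β := by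
  have hfin : (RM m r).Finite := Set.toFinite _
  have := isProbabilityMeasure_uniformOn hfin ⟨0, zero_mem_RM m r⟩
  have hmem : ∀ᵐ c ∂(uniformOn (RM m r)), c ∈ RM m r :=
    ae_cond_mem hfin.measurableSet
  rw [errProb, ← integral_indicator_one (Set.toFinite _).measurableSet,
    integral_prod _ Integrable.of_finite]
  have hinner (c : Word m) : ∫ ν, Set.indicator {x : Word m × Word m | dec (x.1 + x.2) ≠ x.1}
      (1 : Word m × Word m → ℝ) (c, ν) ∂(noise p m) = errProbOf p dec c := by
    rw [errProbOf, ← integral_indicator_one (Set.toFinite _).measurableSet]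
    rfl
  simp only [hinner]
  calc ∫ c, errProbOf p dec c ∂(uniformOn (RM m r)) ≤ ∫ _, β ∂(uniformOn (RM m r)) :=
        integral_mono_ae Integrable.of_finite Integrable.of_finite (hmem.mono h)
    _ = β := by simp

/-- The exponent in terms of `η`: both `1 - 2 pbar` and `2 η` are powers of `1 - 2p`. -/
lemma two_mul_eta_pbar (p : ℝ) {r : ℕ} (hr : 2 ≤ r) :
    2 * eta (pbar p r) = (1 - 2 * p) ^ 2 ^ (r - 1) := by
  obtain ⟨k, rfl⟩ := Nat.exists_eq_add_of_le' hr
  have h : 2 * eta (pbar p (k + 2)) = ((1 - 2 * p) ^ 2 ^ k) ^ 2 := by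
    simp only [eta, pbar, Nat.add_sub_cancel]; ring
  rw [h, ← pow_mul, ← pow_succ]
  rfl

end RPA

theorem theorem1 (p : unitInterval) (hp0 : 0 < (p : ℝ)) (hp : (p : ℝ) < 1 / 2)
    (m r : ℕ) (hr : 2 ≤ r) (hrm : r ≤ m)
    (D : ∀ n : ℕ, RPA.Word n → RPA.Word n) (hD : RPA.IsFirstOrderML D)
    (e : RPA.CosetIndexing) (M : ℕ) (hM : 1 ≤ M)
    (ε : ℝ) (hε0 : 0 < ε) (hε : ε < RPA.eta (RPA.pbar p r)) :
    RPA.errProb p m r (RPA.rpa D e M r m) ≤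
        32 * ((2 : ℝ) ^ m) ^ (r + 1) * Real.exp (-(((2 : ℝ) ^ m * ε ^ 2) / 2 ^ (r + 1))) ∧
      ∀ c ∈ RPA.RM m r, RPA.errProbOf p (RPA.rpa D e M r m) c ≤
        32 * ((2 : ℝ) ^ m) ^ (r + 1) * Real.exp (-(((2 : ℝ) ^ m * ε ^ 2) / 2 ^ (r + 1))) := by
  have key : ∀ c ∈ RPA.RM m r, RPA.errProbOf p (RPA.rpa D e M r m) c ≤
      32 * ((2 : ℝ) ^ m) ^ (r + 1) * Real.exp (-(((2 : ℝ) ^ m * ε ^ 2) / 2 ^ (r + 1))) := by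
    intro c hc
    have hε2 : ε ^ 2 ≤ (1 - 2 * (p : ℝ)) ^ 2 ^ r := by
      have h1 : (1 - 2 * (p : ℝ)) ^ 2 ^ r = (2 * RPA.eta (RPA.pbar p r)) ^ 2 := by
        rw [RPA.two_mul_eta_pbar _ hr, ← pow_mul, ← pow_succ, Nat.sub_add_cancel (by omega)]
      rw [h1]
      exact pow_le_pow_left₀ hε0.le (by linarith) 2
    obtain ⟨k, rfl⟩ : ∃ k, r = k + 1 := ⟨r - 1, by omega⟩
    refine (RPA.errProbOf_rpa_le hD e hM k p hp0 hp m hrm c hc).trans ?_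
    have hN1 : (1 : ℝ) ≤ 2 ^ m := one_le_pow₀ one_le_two
    refine mul_le_mul (mul_le_mul (by norm_num) (pow_le_pow_right₀ hN1 (by omega))
      (by positivity) (by norm_num)) ?_ (Real.exp_pos _).le (by positivity)
    rw [Real.exp_le_exp, neg_le_neg_iff]
    gcongr
  exact ⟨RPA.errProb_le_of_errProbOf_le p key, key⟩
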